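/- Let $P$ be an infinite field, let $X$ be a finite set with $|X|\neq 1$, and let $F(X)$ be the free Lie algebra over $P$ freely generated by $X$. Let $\mathrm{End}(F(X))$ be the semigroup, under composition, of all Lie algebra endomorphisms of $F(X)$, let $\mathrm{Aut}(F(X))$ be its group of invertible elements, and let $\mathrm{Aut}_l(F(X))\le \mathrm{Aut}(F(X))$ be the subgroup of linear automorphisms, i.e. those sending every $x\in X$ to a $P$-linear combination of elements of $X$. A semi-automorphism of $F(X)$ is a pair $(\sigma,s)$ where $\sigma$ is an automorphism of the field $P$ and $s$ is an automorphism of the Lie ring $F(X)$ such that $s(\lambda a)=\sigma(\lambda)s(a)$ for all $\lambda\in P$, $a\in F(X)$. An automorphism $\xi$ of the semigroup $\mathrm{End}(F(X))$ is called semi-inner if there is a semi-automorphism $(\sigma,s)$ of $F(X)$ with $\xi(\nu)=s\nu s^{-1}$ for every $\nu\in\mathrm{End}(F(X))$. Then the following two conditions are equivalent. 1. Every automorphism of the semigroup $\mathrm{End}(F(X))$ is semi-inner. 2. For every automorphism $\xi$ of the semigroup $\mathrm{End}(F(X))$, the group $\xi(\mathrm{Aut}_l(F(X)))$ is conjugate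 to $\mathrm{Aut}_l(F(X))$ in $\mathrm{Aut}(F(X))$. -/

import Mathlib

/-- The set of endomorphisms of the free Lie algebra `F(X)` over `P`. -/
abbrev FreeLieEnd (P : Type*) (X : Type*) [CommRing P] : Type _ :=
  FreeLieAlgebra P X →ₗ⁅P⁆ FreeLieAlgebra P X

/-- `End(F(X))` as a semigroup (with identity) under composition `(f * g)(a) = f (g a)`. -/
noncomputable instance FreeLieEnd.instMonoid (P : Type*) (X : Type*) [CommRing P] :
    Monoid (FreeLieEnd P X) where
  mul f g := f.comp g
  one := 1
  mul_assoc _ _ _ := rfl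
  one_mul _ := rfl
  mul_one _ := rfl

theorem FreeLieEnd.mul_apply {P : Type*} {X : Type*} [CommRing P]
    (f g : FreeLieEnd P X) (a : FreeLieAlgebra P X) : (f * g) a = f (g a) := rfl

theorem FreeLieEnd.one_apply {P : Type*} {X : Type*} [CommRing P]
    (a : FreeLieAlgebra P X) : (1 : FreeLieEnd P X) a = a := rfl

/-- `Aut(F(X))`, the group of invertible elements of `End(F(X))`. -/
abbrev FreeLieAut (P : Type*) (X : Type*) [CommRing P] : Type _ := (FreeLieEnd P X)ˣ

/-- The space of linear polynomials `a₁ x₁ + ⋯ + aₙ xₙ` in `F(X)`. -/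
noncomputable def freeLieLinear (P : Type*) (X : Type*) [CommRing P] : Submodule P (FreeLieAlgebra P X) :=
  Submodule.span P (Set.range (FreeLieAlgebra.of P))

/-- An endomorphism is linear if it sends every free generator to a linear polynomial. -/
def FreeLieEnd.IsLinear {P : Type*} {X : Type*} [CommRing P] (f : FreeLieEnd P X) : Prop :=
  ∀ x : X, f (FreeLieAlgebra.of P x) ∈ freeLieLinear P X

theorem FreeLieEnd.IsLinear.apply_mem {P : Type*} {X : Type*} [CommRing P] {f : FreeLieEnd P X}
    (hf : f.IsLinear) {a : FreeLieAlgebra P X} (ha : a ∈ freeLieLinear P X) :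
    f a ∈ freeLieLinear P X := by
  have h : freeLieLinear P X ≤ (freeLieLinear P X).comap (f : FreeLieAlgebra P X →ₗ[P] _) := by
    rw [freeLieLinear, Submodule.span_le]
    rintro _ ⟨x, rfl⟩
    exact hf x
  exact h ha

theorem FreeLieAut.isLinear_inv {P : Type*} {X : Type*} [Field P] [Finite X]
    {g : FreeLieAut P X} (hg : (g : FreeLieEnd P X).IsLinear) :
    ((g⁻¹ : FreeLieAut P X) : FreeLieEnd P X).IsLinear := by
  have hinv : ∀ a, ((g⁻¹ : FreeLieAut P X) : FreeLieEnd P X) ((g : FreeLieEnd P X) a) = a := by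
    intro a
    rw [← FreeLieEnd.mul_apply, Units.inv_mul, FreeLieEnd.one_apply]
  have : FiniteDimensional P (freeLieLinear P X) :=
    FiniteDimensional.span_of_finite P (Set.finite_range _)
  let r : freeLieLinear P X →ₗ[P] freeLieLinear P X :=
    ((g : FreeLieEnd P X) : FreeLieAlgebra P X →ₗ[P] FreeLieAlgebra P X).restrict
      (fun _ ha => hg.apply_mem ha)
  have hr : Function.Injective r := by
    intro a b hab
    apply Subtype.ext
    have h : (g : FreeLieEnd P X) a = (g : FreeLieEnd P X) b := congrArg Subtype.val hab
    rw [← hinv a, ← hinv b, h]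
  intro x
  obtain ⟨b, hb⟩ := LinearMap.injective_iff_surjective.mp hr
    ⟨FreeLieAlgebra.of P x, Submodule.subset_span ⟨x, rfl⟩⟩
  have h : (g : FreeLieEnd P X) b = FreeLieAlgebra.of P x := congrArg Subtype.val hb
  rw [← h, hinv]
  exact b.2

/-- `Aut_l(F(X))`, the group of linear automorphisms of `F(X)`, for `X` finite. -/
def freeLieLinearAut (P : Type*) (X : Type*) [Field P] [Finite X] :
    Subgroup (FreeLieAut P X) where
  carrier := {g | (g : FreeLieEnd P X).IsLinear}
  mul_mem' ha hb x := ha.apply_mem (hb x)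
  one_mem' x := Submodule.subset_span ⟨x, rfl⟩
  inv_mem' hg := FreeLieAut.isLinear_inv hg

/-- A semi-isomorphism `(σ, s) : A → B` of Lie algebras over `P`: an automorphism `σ` of `P`
and an isomorphism of Lie rings `s` with `s (c • a) = σ c • s a`. -/
structure LieSemiEquiv (P : Type*) (A : Type*) (B : Type*) [CommRing P]
    [LieRing A] [LieAlgebra P A] [LieRing B] [LieAlgebra P B] where
  scalar : P ≃+* P
  toAddEquiv : A ≃+ B
  map_lie : ∀ a b : A, toAddEquiv ⁅a, b⁆ = ⁅toAddEquiv a, toAddEquiv b⁆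
  map_smul : ∀ (c : P) (a : A), toAddEquiv (c • a) = scalar c • toAddEquiv a

/-- An automorphism `ξ` of the semigroup `End(F(X))` is semi-inner if `ξ ν = s ν s⁻¹` for all `ν`,
for some semi-automorphism `(σ, s)` of `F(X)`. -/
def FreeLieEnd.IsSemiInner {P : Type*} {X : Type*} [CommRing P]
    (ξ : FreeLieEnd P X ≃* FreeLieEnd P X) : Prop :=
  ∃ s : LieSemiEquiv P (FreeLieAlgebra P X) (FreeLieAlgebra P X),
    ∀ (ν : FreeLieEnd P X) (a : FreeLieAlgebra P X),
      ξ ν a = s.toAddEquiv (ν (s.toAddEquiv.symm a))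

/-! A semi-automorphism `s` factors as a Lie automorphism `s.linearPart` after the coefficient map
`mapCoeff`. The latter fixes the generators and preserves linear polynomials, so conjugation by `s`
and by `s.linearPart` move the linear group to the same subgroup.

Conversely, after an inner correction `ξ` preserves the linear group. For at least two generators,
the central elements of that group are scalings. Over an infinite field, an endomorphism commuting
with all nonzero scalings is linear, because homogeneous components are their weight spaces. Hence
`ξ` preserves linearity of all endomorphisms (`isLinear_map_iff`).

The endomorphisms `assign x a` then act as matrix units and yield a map `t` with `t ∘ ν = ξ ν ∘ t`,
normalised to fix the generators (`exists_conj_and_intertwiner`). Evaluating `t` at `x + y`, `c • x`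
and `⁅x, y⁆` and substituting arbitrary elements for the generators shows that `t` is additive,
semilinear, and multiplicative up to a constant `k`; then `k • t` is the required semi-automorphism.
-/

namespace FreeLieAlgebra

variable {P : Type*} {X : Type*}

/-! ### Degree components and the weights of scalings. -/

section CommRing

variable [CommRing P]

/-- Iterated brackets of free generators, indexed by the number of generators involved. -/
inductive IsBracketMonomial : ℕ → FreeLieAlgebra P X → Prop
  | of (x : X) : IsBracketMonomial 1 (of P x)
  | lie {d e : ℕ} {a b : FreeLieAlgebra P X} :
      IsBracketMonomial d a → IsBracketMonomial e b → IsBracketMonomial (d + e) ⁅a, b⁆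

theorem IsBracketMonomial.pos {d : ℕ} {a : FreeLieAlgebra P X} (h : IsBracketMonomial d a) :
    0 < d := by
  induction h with
  | of => exact Nat.one_pos
  | lie _ _ h _ => exact Nat.add_pos_left h _

/-- The degree is a variable with an equation so that `cases` need not unify `d + e` with a numeral.
-/
theorem IsBracketMonomial.eq_of_of_eq_one {d : ℕ} {a : FreeLieAlgebra P X}
    (h : IsBracketMonomial d a) (hd : d = 1) : ∃ x, a = FreeLieAlgebra.of P x := by
  cases h with
  | of x => exact ⟨x, rfl⟩
  | lie ha hb =>
    have := ha.pos
    have := hb.pos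
    omega

theorem IsBracketMonomial.eq_lie_of_eq_two {d : ℕ} {a : FreeLieAlgebra P X}
    (h : IsBracketMonomial d a) (hd : d = 2) :
    ∃ x y : X, a = ⁅FreeLieAlgebra.of P x, FreeLieAlgebra.of P y⁆ := by
  cases h with
  | of x => omega
  | lie ha hb =>
    have := ha.pos
    have := hb.pos
    obtain ⟨x, rfl⟩ := ha.eq_of_of_eq_one (by omega)
    obtain ⟨y, rfl⟩ := hb.eq_of_of_eq_one (by omega)
    exact ⟨x, y, rfl⟩

variable (P X) in
/-- The homogeneous component of degree `d` of the free Lie algebra. -/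
noncomputable def homogeneous (d : ℕ) : Submodule P (FreeLieAlgebra P X) :=
  Submodule.span P {a | IsBracketMonomial d a}

/-- A Lie subalgebra containing the free generators is everything. -/
theorem induction_lieSubalgebra (K : LieSubalgebra P (FreeLieAlgebra P X))
    (hK : ∀ x, of P x ∈ K) (a : FreeLieAlgebra P X) : a ∈ K := by
  have h : K.incl.comp (lift P fun x => (⟨of P x, hK x⟩ : K)) = LieHom.id := by
    ext x
    simp
  rw [← LieHom.id_apply (R := P) a, ← h]
  exact Subtype.property _

theorem lie_mem_homogeneous {d e : ℕ} {a b : FreeLieAlgebra P X}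
    (ha : a ∈ homogeneous P X d) (hb : b ∈ homogeneous P X e) :
    ⁅a, b⁆ ∈ homogeneous P X (d + e) := by
  induction ha using Submodule.span_induction with
  | mem a ha =>
    induction hb using Submodule.span_induction with
    | mem b hb => exact Submodule.subset_span (ha.lie hb)
    | zero => simp
    | add b c _ _ hb hc => rw [lie_add]; exact add_mem hb hc
    | smul r b _ hb => rw [lie_smul]; exact Submodule.smul_mem _ _ hb
  | zero => simp
  | add a c _ _ ha hc => rw [add_lie]; exact add_mem ha hc
  | smul r a _ ha => rw [smul_lie]; exact Submodule.smul_mem _ _ ha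

theorem mem_iSup_homogeneous (a : FreeLieAlgebra P X) : a ∈ ⨆ d, homogeneous P X d := by
  let K : LieSubalgebra P (FreeLieAlgebra P X) :=
    { (⨆ d, homogeneous P X d : Submodule P (FreeLieAlgebra P X)) with
      lie_mem' := by
        intro a b ha hb
        change a ∈ ⨆ d, homogeneous P X d at ha
        change b ∈ ⨆ d, homogeneous P X d at hb
        change ⁅a, b⁆ ∈ ⨆ d, homogeneous P X d
        induction ha using Submodule.iSup_induction' with
        | mem d a ha =>
          induction hb using Submodule.iSup_induction' with
          | mem e b hb => exact Submodule.mem_iSup_of_mem (d + e) (lie_mem_homogeneous ha hb)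
          | zero => simp
          | add b c _ _ hb hc => rw [lie_add]; exact add_mem hb hc
        | zero => simp
        | add a c _ _ ha hc => rw [add_lie]; exact add_mem ha hc }
  exact induction_lieSubalgebra K
    (fun x => Submodule.mem_iSup_of_mem (p := homogeneous P X) 1
      (Submodule.subset_span (.of x))) a

variable (X) in
/-- The endomorphism multiplying each free generator by the scalar `c`. -/
noncomputable def scale (c : P) : FreeLieEnd P X := lift P fun x => c • of P x

@[simp]
theorem scale_of (c : P) (x : X) : scale X c (of P x) = c • of P x := by
  simp [scale]

theorem scale_apply_of_mem_homogeneous (c : P) {d : ℕ} {a : FreeLieAlgebra P X}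
    (ha : a ∈ homogeneous P X d) : scale X c a = c ^ d • a := by
  induction ha using Submodule.span_induction with
  | mem a ha =>
    induction ha with
    | of x => simp
    | lie _ _ ha hb => rw [LieHom.map_lie, ha, hb, smul_lie, lie_smul, smul_smul, pow_add]
  | zero => simp
  | add a b _ _ ha hb => rw [map_add, ha, hb, smul_add]
  | smul r a _ ha => rw [map_smul, ha, smul_comm]

theorem homogeneous_one : homogeneous P X 1 = freeLieLinear P X := by
  apply le_antisymm
  · refine Submodule.span_mono fun a ha => ?_
    obtain ⟨x, rfl⟩ := IsBracketMonomial.eq_of_of_eq_one ha rfl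
    exact ⟨x, rfl⟩
  · refine Submodule.span_mono ?_
    rintro _ ⟨x, rfl⟩
    exact .of x

end CommRing

section Field

variable [Field P] [Infinite P]

/-- Each linear functional turns the relation into a polynomial in `c` with infinitely many roots.
Its coefficient in degree `d ≠ k` is the value of the functional on `w d`, since the subtracted
powers only affect degree `k`. -/
theorem eq_zero_of_forall_sum_pow_smul_eq_zero {M : Type*} [AddCommGroup M] [Module P M]
    {s : Finset ℕ} {k : ℕ} {w : ℕ → M}
    (h : ∀ c : P, c ≠ 0 → ∑ d ∈ s, (c ^ d - c ^ k) • w d = 0) {d : ℕ} (hd : d ∈ s)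
    (hk : d ≠ k) : w d = 0 := by
  rw [← Module.forall_dual_apply_eq_zero_iff P]
  intro l
  let p : Polynomial P := ∑ d ∈ s, Polynomial.C (l (w d)) * (Polynomial.X ^ d - Polynomial.X ^ k)
  have hp : p = 0 := by
    refine Polynomial.eq_zero_of_infinite_isRoot p
      (Set.Infinite.mono (s := {0}ᶜ) ?_ (Set.finite_singleton 0).infinite_compl)
    intro c hc
    have := congrArg l (h c hc)
    simp only [map_sum, map_smul, smul_eq_mul, map_zero] at this
    simp only [Set.mem_ofPred_eq, Polynomial.IsRoot, p, Polynomial.eval_finsetSum]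
    rw [← this]
    refine Finset.sum_congr rfl fun d _ => ?_
    simp [mul_comm]
  have := congrArg (fun q => Polynomial.coeff q d) hp
  simpa [p, Polynomial.finsetSum_coeff, Polynomial.coeff_X_pow, hk, hd, mul_sub] using this

/-- Over an infinite field, homogeneous components are weight spaces of the scalings. -/
theorem mem_homogeneous_of_scale {k : ℕ} {a : FreeLieAlgebra P X}
    (h : ∀ c : P, c ≠ 0 → scale X c a = c ^ k • a) : a ∈ homogeneous P X k := by
  obtain ⟨f, hf, hsum⟩ := (Submodule.mem_iSup_iff_exists_finsupp _ _).1 (mem_iSup_homogeneous a)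
  have hsum' : ∑ d ∈ f.support, f d = a := hsum
  have hz : ∀ c : P, c ≠ 0 → ∑ d ∈ f.support, (c ^ d - c ^ k) • f d = 0 := by
    intro c hc
    have := h c hc
    rw [← hsum', map_sum, Finset.smul_sum, ← sub_eq_zero, ← Finset.sum_sub_distrib] at this
    rw [← this]
    refine Finset.sum_congr rfl fun d _ => ?_
    rw [scale_apply_of_mem_homogeneous c (hf d), sub_smul]
  rw [← hsum']
  refine sum_mem fun d hd => ?_
  by_cases hk : d = k
  · exact hk ▸ hf d
  · rw [eq_zero_of_forall_sum_pow_smul_eq_zero hz hd hk]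
    exact zero_mem _

end Field

end FreeLieAlgebra

/-! ### Semilinear maps on the free Lie algebra. -/

namespace FreeLieAlgebra

variable {P : Type*} {X : Type*} [CommRing P]

/-- A Lie algebra with scalar action twisted by a ring endomorphism. -/
def Twist (_ : P →+* P) (A : Type*) : Type _ := A

instance (σ : P →+* P) (A : Type*) [LieRing A] : LieRing (Twist σ A) := inferInstanceAs (LieRing A)

noncomputable instance (σ : P →+* P) (A : Type*) [LieRing A] [LieAlgebra P A] :
    LieAlgebra P (Twist σ A) where
  toModule := Module.compHom A σ
  lie_smul c a b := lie_smul (σ c) (show A from a) (show A from b)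

variable (X) in
/-- The semilinear endomorphism fixing the free generators and acting by `σ` on coefficients,
as a Lie algebra homomorphism to the twisted algebra. -/
noncomputable def mapCoeffTwist (σ : P →+* P) :
    FreeLieAlgebra P X →ₗ⁅P⁆ Twist σ (FreeLieAlgebra P X) :=
  lift P fun x => (of P x : FreeLieAlgebra P X)

variable (X) in
/-- The semilinear endomorphism fixing the free generators and acting by `σ` on coefficients. -/
noncomputable def mapCoeff (σ : P →+* P) (a : FreeLieAlgebra P X) : FreeLieAlgebra P X :=
  mapCoeffTwist X σ a

theorem mapCoeff_of (σ : P →+* P) (x : X) : mapCoeff X σ (of P x) = of P x :=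
  lift_of_apply (R := P) (L := Twist σ (FreeLieAlgebra P X)) _ x

theorem mapCoeff_smul (σ : P →+* P) (c : P) (a : FreeLieAlgebra P X) :
    mapCoeff X σ (c • a) = σ c • mapCoeff X σ a :=
  (mapCoeffTwist X σ).toLinearMap.map_smul c a

theorem mapCoeff_add (σ : P →+* P) (a b : FreeLieAlgebra P X) :
    mapCoeff X σ (a + b) = mapCoeff X σ a + mapCoeff X σ b :=
  (mapCoeffTwist X σ).toLinearMap.map_add a b

theorem mapCoeff_lie (σ : P →+* P) (a b : FreeLieAlgebra P X) :
    mapCoeff X σ ⁅a, b⁆ = ⁅mapCoeff X σ a, mapCoeff X σ b⁆ :=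
  (mapCoeffTwist X σ).map_lie a b

/-- A semilinear Lie map is determined by its values on the free generators. -/
theorem semilinear_ext {σ : P ≃+* P} {f g : FreeLieAlgebra P X → FreeLieAlgebra P X}
    (hf₁ : ∀ a b, f (a + b) = f a + f b) (hf₂ : ∀ a b, f ⁅a, b⁆ = ⁅f a, f b⁆)
    (hf₃ : ∀ (c : P) a, f (c • a) = σ c • f a)
    (hg₁ : ∀ a b, g (a + b) = g a + g b) (hg₂ : ∀ a b, g ⁅a, b⁆ = ⁅g a, g b⁆)
    (hg₃ : ∀ (c : P) a, g (c • a) = σ c • g a)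
    (h : ∀ x, f (of P x) = g (of P x)) (a : FreeLieAlgebra P X) : f a = g a := by
  let K : LieSubalgebra P (FreeLieAlgebra P X) :=
    { carrier := {a | f a = g a}
      add_mem' := fun {a b} ha hb => by
        simp only [Set.mem_ofPred_eq] at *
        rw [hf₁, hg₁, ha, hb]
      zero_mem' := by
        have h₁ := hf₃ 0 0
        have h₂ := hg₃ 0 0
        simp only [map_zero, zero_smul] at h₁ h₂
        exact h₁.trans h₂.symm
      smul_mem' := fun c a ha => by
        simp only [Set.mem_ofPred_eq] at *
        rw [hf₃, hg₃, ha]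
      lie_mem' := fun {a b} ha hb => by
        change f ⁅a, b⁆ = g ⁅a, b⁆
        rw [hf₂, hg₂, show f a = g a from ha, show f b = g b from hb] }
  exact induction_lieSubalgebra K h a

/-- A semilinear map fixing the free generators preserves linear polynomials. -/
theorem semilinear_mem_linear {σ : P ≃+* P} {f : FreeLieAlgebra P X → FreeLieAlgebra P X}
    (hf₁ : ∀ a b, f (a + b) = f a + f b) (hf₃ : ∀ (c : P) a, f (c • a) = σ c • f a)
    (h : ∀ x, f (of P x) = of P x) {a : FreeLieAlgebra P X} (ha : a ∈ freeLieLinear P X) :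
    f a ∈ freeLieLinear P X := by
  induction ha using Submodule.span_induction with
  | mem a ha =>
    obtain ⟨x, rfl⟩ := ha
    rw [h]
    exact Submodule.subset_span ⟨x, rfl⟩
  | zero =>
    have h₁ := hf₃ 0 0
    simp only [map_zero, zero_smul] at h₁
    rw [h₁]
    exact zero_mem _
  | add a b _ _ ha hb => rw [hf₁]; exact add_mem ha hb
  | smul c a _ ha => rw [hf₃]; exact Submodule.smul_mem _ _ ha

end FreeLieAlgebra

/-! ### Factoring semi-automorphisms; semi-inner implies conjugate linear groups. -/

namespace LieSemiEquiv

variable {P : Type*} {X : Type*} [CommRing P]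

open FreeLieAlgebra

theorem symm_smul (s : LieSemiEquiv P (FreeLieAlgebra P X) (FreeLieAlgebra P X)) (c : P)
    (a : FreeLieAlgebra P X) :
    s.toAddEquiv.symm (c • a) = s.scalar.symm c • s.toAddEquiv.symm a := by
  rw [AddEquiv.symm_apply_eq, s.map_smul]
  simp

theorem symm_lie (s : LieSemiEquiv P (FreeLieAlgebra P X) (FreeLieAlgebra P X))
    (a b : FreeLieAlgebra P X) :
    s.toAddEquiv.symm ⁅a, b⁆ = ⁅s.toAddEquiv.symm a, s.toAddEquiv.symm b⁆ := by
  rw [AddEquiv.symm_apply_eq, s.map_lie]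
  simp

/-- The automorphism with the same values on the free generators as a semi-automorphism. -/
noncomputable def linearPart (s : LieSemiEquiv P (FreeLieAlgebra P X) (FreeLieAlgebra P X)) :
    FreeLieEnd P X := lift P fun x => s.toAddEquiv (of P x)

theorem linearPart_of (s : LieSemiEquiv P (FreeLieAlgebra P X) (FreeLieAlgebra P X)) (x : X) :
    s.linearPart (of P x) = s.toAddEquiv (of P x) := by
  simp [linearPart]

/-- Both sides are semilinear Lie maps over the same field automorphism and agree on generators. -/
theorem linearPart_mapCoeff (s : LieSemiEquiv P (FreeLieAlgebra P X) (FreeLieAlgebra P X))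
    (a : FreeLieAlgebra P X) :
    s.linearPart (mapCoeff X (s.scalar : P →+* P) a) = s.toAddEquiv a := by
  refine semilinear_ext (σ := s.scalar)
    (f := fun a => s.linearPart (mapCoeff X (s.scalar : P →+* P) a))
    (g := s.toAddEquiv) ?_ ?_ ?_ (map_add _) s.map_lie s.map_smul ?_ a
  · intro a b
    simp only [mapCoeff_add, map_add]
  · intro a b
    simp only [mapCoeff_lie, LieHom.map_lie]
  · intro c a
    simp only [mapCoeff_smul, RingHom.coe_coe]
    exact _root_.map_smul s.linearPart _ _
  · intro x
    simp only [mapCoeff_of, linearPart_of]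

/-- The inverse of `linearPart`. -/
noncomputable def linearPartInv (s : LieSemiEquiv P (FreeLieAlgebra P X) (FreeLieAlgebra P X)) :
    FreeLieEnd P X where
  toFun a := mapCoeff X (s.scalar : P →+* P) (s.toAddEquiv.symm a)
  map_add' a b := by rw [map_add, mapCoeff_add]
  map_smul' c a := by simp [symm_smul, mapCoeff_smul]
  map_lie' {a b} := by
    change mapCoeff X (s.scalar : P →+* P) (s.toAddEquiv.symm ⁅a, b⁆) = _
    rw [symm_lie, mapCoeff_lie]

theorem linearPartInv_apply (s : LieSemiEquiv P (FreeLieAlgebra P X) (FreeLieAlgebra P X))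
    (a : FreeLieAlgebra P X) :
    s.linearPartInv a = mapCoeff X (s.scalar : P →+* P) (s.toAddEquiv.symm a) := rfl

/-- `linearPart` as a unit of the endomorphism monoid. -/
noncomputable def linearPartUnit (s : LieSemiEquiv P (FreeLieAlgebra P X) (FreeLieAlgebra P X)) :
    FreeLieAut P X where
  val := s.linearPart
  inv := s.linearPartInv
  val_inv := by
    refine LieHom.ext fun a => ?_
    rw [FreeLieEnd.mul_apply, linearPartInv_apply, linearPart_mapCoeff, FreeLieEnd.one_apply,
      AddEquiv.apply_symm_apply]
  inv_val := by
    refine FreeLieAlgebra.hom_ext fun x => ?_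
    rw [FreeLieEnd.mul_apply, linearPart_of, linearPartInv_apply, AddEquiv.symm_apply_apply,
      FreeLieEnd.one_apply, mapCoeff_of]

end LieSemiEquiv

theorem FreeLieEnd.IsSemiInner.map_linearAut {P : Type*} {X : Type*} [Field P] [Finite X]
    {ξ : FreeLieEnd P X ≃* FreeLieEnd P X} (hξ : FreeLieEnd.IsSemiInner ξ) :
    ∃ g : FreeLieAut P X,
      (freeLieLinearAut P X).map (Units.mapEquiv ξ).toMonoidHom =
        (freeLieLinearAut P X).map (MulAut.conj g).toMonoidHom := by
  obtain ⟨s, hs⟩ := hξ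
  have hsymm : ∀ (ν : FreeLieEnd P X) (a : FreeLieAlgebra P X),
      ξ.symm ν a = s.toAddEquiv.symm (ν (s.toAddEquiv a)) := by
    intro ν a
    have := hs (ξ.symm ν) (s.toAddEquiv a)
    rw [MulEquiv.apply_symm_apply, AddEquiv.symm_apply_apply] at this
    rw [this, AddEquiv.symm_apply_apply]
  refine ⟨s.linearPartUnit, le_antisymm ?_ ?_⟩
  · rintro _ ⟨u, hu, rfl⟩
    refine ⟨s.linearPartUnit⁻¹ * Units.mapEquiv ξ u * s.linearPartUnit, ?_, ?_⟩
    · intro x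
      change s.linearPartInv (ξ u (s.linearPart (FreeLieAlgebra.of P x))) ∈ _
      rw [s.linearPart_of, hs, AddEquiv.symm_apply_apply, s.linearPartInv_apply,
        AddEquiv.symm_apply_apply]
      exact FreeLieAlgebra.semilinear_mem_linear (σ := s.scalar)
        (f := FreeLieAlgebra.mapCoeff X (s.scalar : P →+* P)) (FreeLieAlgebra.mapCoeff_add _)
        (FreeLieAlgebra.mapCoeff_smul _) (FreeLieAlgebra.mapCoeff_of _) (hu x)
    · change s.linearPartUnit * _ * s.linearPartUnit⁻¹ = Units.mapEquiv ξ u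
      group
  · rintro _ ⟨u, hu, rfl⟩
    refine ⟨(Units.mapEquiv ξ).symm (s.linearPartUnit * u * s.linearPartUnit⁻¹), ?_, ?_⟩
    · intro x
      change ξ.symm (s.linearPart * u * s.linearPartInv) (FreeLieAlgebra.of P x) ∈ _
      rw [hsymm, FreeLieEnd.mul_apply, FreeLieEnd.mul_apply, s.linearPartInv_apply,
        AddEquiv.symm_apply_apply, FreeLieAlgebra.mapCoeff_of]
      -- `s⁻¹ ∘ s.linearPart` is semilinear over the inverse field automorphism and fixes the
      -- generators.
      refine FreeLieAlgebra.semilinear_mem_linear (σ := s.scalar.symm)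
        (f := fun a => s.toAddEquiv.symm (s.linearPart a)) ?_ ?_ ?_ (hu x)
      · intro a b
        rw [map_add, map_add]
      · intro c a
        rw [map_smul, s.symm_smul]
      · intro x
        rw [s.linearPart_of, AddEquiv.symm_apply_apply]
    · exact (Units.mapEquiv ξ).apply_symm_apply _

/-! ### Coordinates, transvections and the centre of the linear group. -/

namespace FreeLieAlgebra

variable {P : Type*} {X : Type*}

section CommRing

variable [CommRing P]

theorem of_mem_linear (x : X) : of P x ∈ freeLieLinear P X := Submodule.subset_span ⟨x, rfl⟩

open Classical in
/-- The endomorphism sending `x` to `a` and every other free generator to zero. -/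
noncomputable def assign (x : X) (a : FreeLieAlgebra P X) : FreeLieEnd P X := lift P (Pi.single x a)

@[simp]
theorem assign_of_self (x : X) (a : FreeLieAlgebra P X) : assign x a (of P x) = a := by
  simp [assign]

theorem assign_of_ne {x y : X} (h : y ≠ x) (a : FreeLieAlgebra P X) :
    assign x a (of P y) = 0 := by
  simp [assign, h]

@[simp]
theorem assign_zero (x : X) : assign x (0 : FreeLieAlgebra P X) = 0 := by
  refine hom_ext fun y => ?_
  by_cases h : y = x
  · subst h; simp
  · simp [assign_of_ne h]

/-- This identity makes `a ↦ ξ (assign x a) v` an intertwiner for any fixed `v`. -/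
theorem mul_assign (f : FreeLieEnd P X) (x : X) (a : FreeLieAlgebra P X) :
    f * assign x a = assign x (f a) := by
  refine hom_ext fun y => ?_
  rw [FreeLieEnd.mul_apply]
  by_cases h : y = x
  · subst h; simp
  · simp [assign_of_ne h]

open Classical in
/-- The coefficient of a free generator in the linear part. -/
noncomputable def coord (x : X) : FreeLieAlgebra P X →ₗ[P] P :=
  -- With its commutator bracket `P` is abelian, so the lift kills all brackets and reads off only
  -- the linear part.
  letI : LieRing P := LieRing.ofAssociativeRing
  (lift P (L := P) (Pi.single x 1 : X → P)).toLinearMap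

open Classical in
theorem coord_of (x y : X) : coord x (of P y) = (Pi.single x 1 : X → P) y :=
  letI : LieRing P := LieRing.ofAssociativeRing
  lift_of_apply (R := P) (L := P) _ y

@[simp]
theorem coord_of_self (x : X) : coord x (of P x) = 1 := by
  simp [coord_of]

theorem coord_of_ne {x y : X} (h : y ≠ x) : coord x (of P y) = 0 := by
  simp [coord_of, h]

theorem assign_apply_of_mem_linear (x : X) (b : FreeLieAlgebra P X) {a : FreeLieAlgebra P X}
    (ha : a ∈ freeLieLinear P X) : assign x b a = coord x a • b := by
  induction ha using Submodule.span_induction with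
  | mem a ha =>
    obtain ⟨y, rfl⟩ := ha
    by_cases h : y = x
    · subst h; simp
    · simp [assign_of_ne h, coord_of_ne h]
  | zero => simp
  | add a c _ _ ha hc => rw [map_add, map_add, ha, hc, add_smul]
  | smul r a _ ha => rw [map_smul, map_smul, ha, smul_assoc]

theorem eq_sum_coord [Fintype X] {a : FreeLieAlgebra P X} (ha : a ∈ freeLieLinear P X) :
    a = ∑ x, coord x a • of P x := by
  classical
  induction ha using Submodule.span_induction with
  | mem a ha =>
    obtain ⟨y, rfl⟩ := ha
    rw [Finset.sum_eq_single y]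
    · simp
    · intro x _ h
      simp [coord_of_ne h.symm]
    · simp
  | zero => simp
  | add a c _ _ ha hc =>
    conv_lhs => rw [ha, hc]
    simp [add_smul, Finset.sum_add_distrib]
  | smul r a _ ha =>
    conv_lhs => rw [ha]
    simp [Finset.smul_sum, smul_smul]

theorem eq_of_coord_eq [Finite X] {a b : FreeLieAlgebra P X} (ha : a ∈ freeLieLinear P X)
    (hb : b ∈ freeLieLinear P X) (h : ∀ x, coord x a = coord x b) : a = b := by
  have := Fintype.ofFinite X
  rw [eq_sum_coord ha, eq_sum_coord hb]
  simp only [h]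

theorem linearIndependent_of [Finite X] : LinearIndependent P (of P : X → FreeLieAlgebra P X) := by
  classical
  have := Fintype.ofFinite X
  rw [Fintype.linearIndependent_iff]
  intro g hg x
  have := congrArg (coord x) hg
  rw [map_sum, Finset.sum_eq_single x] at this
  · simpa using this
  · intro y _ h
    simp [coord_of_ne h]
  · simp

theorem of_ne_zero [Nontrivial P] (x : X) : of P x ≠ (0 : FreeLieAlgebra P X) := by
  intro h
  have := congrArg (coord x) h
  simp at this

theorem scale_apply_of_mem_linear (c : P) {a : FreeLieAlgebra P X} (ha : a ∈ freeLieLinear P X) :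
    scale X c a = c • a := by
  rw [scale_apply_of_mem_homogeneous c (d := 1) (homogeneous_one (P := P) (X := X) ▸ ha), pow_one]

theorem _root_.FreeLieEnd.IsLinear.commute_scale {f : FreeLieEnd P X} (hf : f.IsLinear) (c : P) :
    scale X c * f = f * scale X c := by
  refine hom_ext fun x => ?_
  rw [FreeLieEnd.mul_apply, FreeLieEnd.mul_apply, scale_apply_of_mem_linear c (hf x), scale_of,
    map_smul]

theorem scale_isLinear (c : P) : (scale X c).IsLinear := fun x => by
  rw [scale_of]
  exact Submodule.smul_mem _ _ (of_mem_linear x)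

theorem scale_mul (c d : P) : scale X c * scale X d = scale X (c * d) := by
  refine hom_ext fun x => ?_
  rw [FreeLieEnd.mul_apply, scale_of, map_smul, scale_of, scale_of, smul_smul, mul_comm]

theorem scale_one : scale X (1 : P) = 1 := by
  refine hom_ext fun x => ?_
  rw [FreeLieEnd.one_apply, scale_of, one_smul]

/-- Scaling by a unit, as an automorphism. -/
noncomputable def scaleUnit (c : Pˣ) : FreeLieAut P X where
  val := scale X (c : P)
  inv := scale X ((c⁻¹ : Pˣ) : P)
  val_inv := by rw [scale_mul, Units.mul_inv, scale_one]
  inv_val := by rw [scale_mul, Units.inv_mul, scale_one]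

open Classical in
/-- The endomorphism adding `c • y` to `x` and fixing every other free generator. -/
noncomputable def transvection (x y : X) (c : P) : FreeLieEnd P X :=
  lift P (Function.update (of P) x (of P x + c • of P y))

theorem transvection_of_self (x y : X) (c : P) :
    transvection x y c (of P x) = of P x + c • of P y := by
  simp [transvection]

theorem transvection_of_ne {x z : X} (h : z ≠ x) (y : X) (c : P) :
    transvection x y c (of P z) = of P z := by
  simp [transvection, h]

theorem transvection_apply_of_mem_linear (x y : X) (c : P) {a : FreeLieAlgebra P X}
    (ha : a ∈ freeLieLinear P X) : transvection x y c a = a + (coord x a * c) • of P y := by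
  induction ha using Submodule.span_induction with
  | mem a ha =>
    obtain ⟨z, rfl⟩ := ha
    by_cases h : z = x
    · subst h; simp [transvection_of_self]
    · simp [transvection_of_ne h, coord_of_ne h]
  | zero => simp
  | add a b _ _ ha hb => rw [map_add, map_add, ha, hb, add_mul, add_smul]; abel
  | smul r a _ ha => rw [map_smul, map_smul, ha, smul_add, smul_smul, smul_eq_mul, mul_assoc]

theorem transvection_isLinear (x y : X) (c : P) : (transvection x y c).IsLinear := fun z => by
  rw [transvection_apply_of_mem_linear x y c (of_mem_linear z)]
  exact add_mem (of_mem_linear z) (Submodule.smul_mem _ _ (of_mem_linear y))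

theorem transvection_mul_neg {x y : X} (h : y ≠ x) (c : P) :
    transvection x y c * transvection x y (-c) = 1 := by
  refine hom_ext fun z => ?_
  rw [FreeLieEnd.mul_apply, FreeLieEnd.one_apply]
  by_cases hz : z = x
  · subst hz
    rw [transvection_of_self, map_add, map_smul, transvection_of_self, transvection_of_ne h]
    simp
  · rw [transvection_of_ne hz, transvection_of_ne hz]

/-- A transvection as an automorphism. -/
noncomputable def transvectionUnit {x y : X} (h : y ≠ x) (c : P) : FreeLieAut P X where
  val := transvection x y c
  inv := transvection x y (-c)
  val_inv := transvection_mul_neg h c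
  inv_val := by simpa using transvection_mul_neg h (-c)

/-- Linear endomorphisms commuting with the transvections are scalings. -/
theorem eq_scale_of_commute_transvection [Finite X] [Nontrivial X] {f : FreeLieEnd P X}
    (hf : f.IsLinear)
    (h : ∀ x y : X, y ≠ x → f * transvection x y 1 = transvection x y 1 * f) :
    ∃ c, f = scale X c := by
  -- Evaluate the commutation relation at `x` and cancel `f x`.
  have key : ∀ x y : X, y ≠ x → f (of P y) = coord x (f (of P x)) • of P y := by
    intro x y hxy
    have := congrArg (fun g : FreeLieEnd P X => g (of P x)) (h x y hxy)
    simp only [FreeLieEnd.mul_apply] at this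
    rw [transvection_of_self, transvection_apply_of_mem_linear x y 1 (hf x), map_add, one_smul,
      mul_one] at this
    exact add_left_cancel this
  have hc : ∀ x y : X, y ≠ x → coord y (f (of P y)) = coord x (f (of P x)) := by
    intro x y hxy
    rw [key x y hxy]
    simp
  obtain ⟨x, -⟩ := exists_pair_ne X
  refine ⟨coord x (f (of P x)), hom_ext fun y => ?_⟩
  rw [scale_of]
  by_cases hy : y = x
  · subst hy
    obtain ⟨z, hz⟩ := exists_ne y
    rw [← hc y z hz]
    exact key z y hz.symm
  · exact key x y hy

end CommRing

section Field

variable [Field P]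

theorem isLinear_of_commute_scale [Infinite P] {f : FreeLieEnd P X}
    (hf : ∀ c : Pˣ, scale X (c : P) * f = f * scale X (c : P)) : f.IsLinear := by
  intro x
  rw [← homogeneous_one]
  refine mem_homogeneous_of_scale fun c hc => ?_
  have := congrArg (fun g : FreeLieEnd P X => g (of P x)) (hf (Units.mk0 c hc))
  simpa [FreeLieEnd.mul_apply] using this

/-- The preimage under `ξ` of a scaling is central in the linear group, hence itself a scaling, and
so commutes with `ν`. Applying `ξ` shows that `ξ ν` commutes with every nonzero scaling. -/
theorem _root_.FreeLieEnd.IsLinear.map_of_map_linearAut [Infinite P] [Finite X] [Nontrivial X]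
    {ξ : FreeLieEnd P X ≃* FreeLieEnd P X}
    (hξ : ∀ u, Units.mapEquiv ξ u ∈ freeLieLinearAut P X ↔ u ∈ freeLieLinearAut P X)
    {ν : FreeLieEnd P X} (hν : ν.IsLinear) : (ξ ν).IsLinear := by
  refine isLinear_of_commute_scale fun c => ?_
  obtain ⟨u, hu⟩ := (Units.mapEquiv ξ).surjective (scaleUnit (X := X) c)
  have hul : u ∈ freeLieLinearAut P X := by
    rw [← hξ, hu]
    exact scale_isLinear (c : P)
  have hcomm : ∀ v ∈ freeLieLinearAut P X, u * v = v * u := by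
    intro v hv
    apply (Units.mapEquiv ξ).injective
    rw [map_mul, map_mul, hu]
    exact Units.ext (FreeLieEnd.IsLinear.commute_scale ((hξ v).2 hv) (c : P))
  obtain ⟨d, hd⟩ := eq_scale_of_commute_transvection hul fun x y h =>
    congrArg Units.val (hcomm (transvectionUnit h 1) (transvection_isLinear x y 1))
  have hu' : ξ u = scale X (c : P) := congrArg Units.val hu
  rw [← hu', ← map_mul, ← map_mul, hd, hν.commute_scale]

theorem _root_.FreeLieEnd.isLinear_map_iff [Infinite P] [Finite X] [Nontrivial X]
    {ξ : FreeLieEnd P X ≃* FreeLieEnd P X}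
    (hξ : ∀ u, Units.mapEquiv ξ u ∈ freeLieLinearAut P X ↔ u ∈ freeLieLinearAut P X)
    (ν : FreeLieEnd P X) : (ξ ν).IsLinear ↔ ν.IsLinear := by
  refine ⟨fun h => ?_, fun h => h.map_of_map_linearAut hξ⟩
  have hξ' : ∀ u, Units.mapEquiv ξ.symm u ∈ freeLieLinearAut P X ↔ u ∈ freeLieLinearAut P X := by
    intro u
    rw [← hξ]
    have : Units.mapEquiv ξ (Units.mapEquiv ξ.symm u) = u := (Units.mapEquiv ξ).apply_symm_apply u
    rw [this]
  simpa using h.map_of_map_linearAut hξ'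

/-- A linearly independent family of linear polynomials is the image of the free generators under
a linear automorphism. -/
theorem exists_linearAut [Finite X] {v : X → FreeLieAlgebra P X}
    (hv : ∀ x, v x ∈ freeLieLinear P X) (hli : LinearIndependent P v) :
    ∃ h ∈ freeLieLinearAut P X, ∀ x, (h : FreeLieEnd P X) (of P x) = v x := by
  have := Fintype.ofFinite X
  let b₀ : Module.Basis X P (freeLieLinear P X) := Module.Basis.span linearIndependent_of
  have hb₀ : ∀ x, (b₀ x : FreeLieAlgebra P X) = of P x := fun x => by
    exact congrArg Subtype.val (Module.Basis.span_apply linearIndependent_of x)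
  rcases isEmpty_or_nonempty X with hX | hX
  · exact ⟨1, one_mem _, fun x => hX.elim x⟩
  let w : X → freeLieLinear P X := fun x => ⟨v x, hv x⟩
  have hw : LinearIndependent P w :=
    LinearIndependent.of_comp (freeLieLinear P X).subtype hli
  let b : Module.Basis X P (freeLieLinear P X) :=
    basisOfLinearIndependentOfCardEqFinrank hw (Module.finrank_eq_card_basis b₀).symm
  have hb : ∀ x, (b x : FreeLieAlgebra P X) = v x := fun x => by simp [b, w]
  let T := b₀.equiv b (Equiv.refl X)
  have lift_apply : ∀ (S : freeLieLinear P X →ₗ[P] freeLieLinear P X) (a : freeLieLinear P X),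
      lift P (fun x => (S (b₀ x) : FreeLieAlgebra P X)) (a : FreeLieAlgebra P X) = S a := by
    intro S a
    have : ((lift P (fun x => (S (b₀ x) : FreeLieAlgebra P X)) : FreeLieEnd P X) :
        FreeLieAlgebra P X →ₗ[P] FreeLieAlgebra P X) ∘ₗ (freeLieLinear P X).subtype =
          (freeLieLinear P X).subtype ∘ₗ S := by
      refine b₀.ext fun x => ?_
      simp [hb₀]
    exact LinearMap.congr_fun this a
  refine ⟨⟨lift P fun x => (T (b₀ x) : FreeLieAlgebra P X),
    lift P fun x => (T.symm (b₀ x) : FreeLieAlgebra P X), ?_, ?_⟩, ?_, ?_⟩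
  · refine hom_ext fun x => ?_
    rw [FreeLieEnd.mul_apply, FreeLieEnd.one_apply, lift_of_apply]
    exact (lift_apply T.toLinearMap _).trans (by simp [hb₀])
  · refine hom_ext fun x => ?_
    rw [FreeLieEnd.mul_apply, FreeLieEnd.one_apply, lift_of_apply]
    exact (lift_apply T.symm.toLinearMap _).trans (by simp [hb₀])
  · intro x
    simp
  · intro x
    simp [T, hb]

end Field

end FreeLieAlgebra

/-! ### Intertwiners and the converse implication. -/

namespace FreeLieEnd

open FreeLieAlgebra

variable {P : Type*} {X : Type*}

section CommRing

variable [CommRing P]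

/-- Conjugation by an automorphism, on the monoid of endomorphisms. -/
noncomputable def conj (g : FreeLieAut P X) : FreeLieEnd P X ≃* FreeLieEnd P X where
  toFun ν := g * ν * (g⁻¹ : FreeLieAut P X)
  invFun ν := (g⁻¹ : FreeLieAut P X) * ν * g
  left_inv ν := by simp [mul_assoc]
  right_inv ν := by simp [mul_assoc]
  map_mul' μ ν := by simp [mul_assoc]

theorem conj_apply (g : FreeLieAut P X) (ν : FreeLieEnd P X) :
    conj g ν = g * ν * (g⁻¹ : FreeLieAut P X) := rfl

theorem inv_apply_apply (g : FreeLieAut P X) (a : FreeLieAlgebra P X) :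
    ((g⁻¹ : FreeLieAut P X) : FreeLieEnd P X) ((g : FreeLieEnd P X) a) = a := by
  rw [← mul_apply, Units.inv_mul, one_apply]

theorem apply_inv_apply (g : FreeLieAut P X) (a : FreeLieAlgebra P X) :
    (g : FreeLieEnd P X) (((g⁻¹ : FreeLieAut P X) : FreeLieEnd P X) a) = a := by
  rw [← mul_apply, Units.mul_inv, one_apply]

theorem IsSemiInner.of_trans_conj {ξ : FreeLieEnd P X ≃* FreeLieEnd P X} {g : FreeLieAut P X}
    (h : IsSemiInner (ξ.trans (conj g))) : IsSemiInner ξ := by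
  obtain ⟨s, hs⟩ := h
  let e : FreeLieAlgebra P X ≃+ FreeLieAlgebra P X :=
    { toFun := ((g⁻¹ : FreeLieAut P X) : FreeLieEnd P X)
      invFun := (g : FreeLieEnd P X)
      left_inv := apply_inv_apply g
      right_inv := inv_apply_apply g
      map_add' := map_add _ }
  refine ⟨⟨s.scalar, s.toAddEquiv.trans e, fun a b => ?_, fun c a => ?_⟩, fun ν a => ?_⟩
  · exact (congrArg e (s.map_lie a b)).trans
      (LieHom.map_lie ((g⁻¹ : FreeLieAut P X) : FreeLieEnd P X) _ _)
  · exact (congrArg e (s.map_smul c a)).trans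
      (map_smul ((g⁻¹ : FreeLieAut P X) : FreeLieEnd P X) _ _)
  · have := hs ν ((g : FreeLieEnd P X) a)
    rw [MulEquiv.trans_apply, conj_apply, mul_apply, mul_apply, inv_apply_apply] at this
    change _ = ((g⁻¹ : FreeLieAut P X) : FreeLieEnd P X)
      (s.toAddEquiv (ν (s.toAddEquiv.symm ((g : FreeLieEnd P X) a))))
    rw [← this, inv_apply_apply]

/-- Zero is the absorbing element of the monoid. -/
theorem map_zero_of_mulEquiv (ξ : FreeLieEnd P X ≃* FreeLieEnd P X) : ξ 0 = 0 := by
  have h₀ : ∀ f : FreeLieEnd P X, 0 * f = 0 := fun f => rfl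
  have h₁ : ∀ f : FreeLieEnd P X, f * 0 = 0 := fun f => LieHom.ext fun a => map_zero f
  calc ξ 0 = ξ (0 * ξ.symm 0) := by rw [h₀]
    _ = 0 := by rw [map_mul, ξ.apply_symm_apply, h₁]

end CommRing

variable [Field P]

/-- Up to conjugation by a linear automorphism, an automorphism of the endomorphism monoid that
preserves linearity is induced by a map fixing the free generators. -/
theorem exists_conj_and_intertwiner [Finite X] [Nonempty X]
    (ξ : FreeLieEnd P X ≃* FreeLieEnd P X) (hξ : ∀ ν, (ξ ν).IsLinear ↔ ν.IsLinear) :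
    ∃ g ∈ freeLieLinearAut P X, ∃ t : FreeLieAlgebra P X → FreeLieAlgebra P X,
      (∀ x, t (of P x) = of P x) ∧ ∀ ν a, t (ν a) = ξ.trans (conj g) ν (t a) := by
  obtain ⟨x₀⟩ := ‹Nonempty X›
  have hlin : ∀ x y : X, (ξ (assign y (of P x))).IsLinear := by
    intro x y
    rw [hξ]
    intro z
    rw [assign_apply_of_mem_linear y _ (of_mem_linear z)]
    exact Submodule.smul_mem _ _ (of_mem_linear x)
  obtain ⟨w, hw⟩ : ∃ w, ξ (assign x₀ (of P x₀)) (of P w) ≠ 0 := by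
    by_contra! h
    have h₁ : ξ (assign x₀ (of P x₀)) = ξ 0 := by
      rw [map_zero_of_mulEquiv]
      exact hom_ext h
    have h₂ := congrArg (fun f : FreeLieEnd P X => f (of P x₀)) (ξ.injective h₁)
    simp only [assign_of_self] at h₂
    exact of_ne_zero x₀ h₂
  set v₀ := ξ (assign x₀ (of P x₀)) (of P w) with hv₀
  let s : FreeLieAlgebra P X → FreeLieAlgebra P X := fun a => ξ (assign x₀ a) v₀
  have hs : ∀ ν a, s (ν a) = ξ ν (s a) := by
    intro ν a
    simp only [s]
    rw [← mul_assign, map_mul, mul_apply]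
  -- `assign x₀ (of P x₀)` is idempotent, so its image under `ξ` fixes `v₀`, which lies in its
  -- range.
  have hs₀ : s (of P x₀) = v₀ := by
    simp only [s]
    rw [hv₀, ← mul_apply, ← map_mul, mul_assign, assign_of_self]
  have hs_zero : s 0 = 0 := by
    simp only [s]
    rw [assign_zero, map_zero_of_mulEquiv]
    rfl
  have hsl : ∀ x, s (of P x) ∈ freeLieLinear P X := fun x =>
    (hlin x x₀).apply_mem (hlin x₀ x₀ w)
  have hs_ne : ∀ x, s (of P x) ≠ 0 := by
    intro x h
    have := hs (assign x (of P x₀)) (of P x)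
    rw [assign_of_self, hs₀, h, map_zero] at this
    exact hw this
  -- Applying `ξ (assign y (of P y))` to a linear relation isolates its `y`-term.
  have hli : LinearIndependent P fun x => s (of P x) := by
    classical
    have := Fintype.ofFinite X
    rw [Fintype.linearIndependent_iff]
    intro c hc y
    have := congrArg (ξ (assign y (of P y))) hc
    rw [map_sum, map_zero, Finset.sum_eq_single y] at this
    · rw [map_smul, ← hs, assign_of_self, smul_eq_zero] at this
      exact this.resolve_right (hs_ne y)
    · intro z _ h
      rw [map_smul, ← hs, assign_of_ne h, hs_zero, smul_zero]
    · simp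
  obtain ⟨h, hh, hhs⟩ := exists_linearAut hsl hli
  refine ⟨h⁻¹, inv_mem hh, fun a => ((h⁻¹ : FreeLieAut P X) : FreeLieEnd P X) (s a),
    fun x => ?_, fun ν a => ?_⟩
  · beta_reduce
    rw [← hhs, inv_apply_apply]
  · beta_reduce
    rw [MulEquiv.trans_apply, conj_apply, mul_apply, mul_apply, inv_inv, apply_inv_apply, hs]

section Intertwiner

variable {ξ : FreeLieEnd P X ≃* FreeLieEnd P X} {t : FreeLieAlgebra P X → FreeLieAlgebra P X}

theorem map_apply_of (hof : ∀ x, t (of P x) = of P x) (ht : ∀ ν a, t (ν a) = ξ ν (t a))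
    (ν : FreeLieEnd P X) (x : X) : ξ ν (of P x) = t (ν (of P x)) := by
  rw [ht, hof]

/-- Elements are encoded by endomorphisms constant on generators; on these `ξ` acts through `t`, so
bijectivity passes from `ξ` to `t`. -/
theorem intertwiner_bijective [Nonempty X] (hof : ∀ x, t (of P x) = of P x)
    (ht : ∀ ν a, t (ν a) = ξ ν (t a)) : Function.Bijective t := by
  obtain ⟨x⟩ := ‹Nonempty X›
  constructor
  · intro a b hab
    have : ξ (lift P fun _ : X => a) = ξ (lift P fun _ : X => b) := by
      refine hom_ext fun y => ?_
      rw [map_apply_of hof ht, map_apply_of hof ht, lift_of_apply, lift_of_apply, hab]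
    have := congrArg (fun f : FreeLieEnd P X => f (of P x)) (ξ.injective this)
    simpa using this
  · intro b
    refine ⟨ξ.symm (lift P fun _ : X => b) (of P x), ?_⟩
    rw [← map_apply_of hof ht, MulEquiv.apply_symm_apply, lift_of_apply]

theorem intertwiner_zero [Nonempty X] (ht : ∀ ν a, t (ν a) = ξ ν (t a)) : t 0 = 0 := by
  have := ht 0 0
  rwa [map_zero_of_mulEquiv] at this

theorem intertwiner_mem_linear_iff [Nonempty X] (hξ : ∀ ν, (ξ ν).IsLinear ↔ ν.IsLinear)
    (hof : ∀ x, t (of P x) = of P x) (ht : ∀ ν a, t (ν a) = ξ ν (t a))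
    (a : FreeLieAlgebra P X) : t a ∈ freeLieLinear P X ↔ a ∈ freeLieLinear P X := by
  have h := hξ (lift P fun _ : X => a)
  simpa only [IsLinear, map_apply_of hof ht, lift_of_apply, forall_const] using h

theorem map_assign_self [Nonempty X] (hof : ∀ x, t (of P x) = of P x)
    (ht : ∀ ν a, t (ν a) = ξ ν (t a)) (x : X) :
    ξ (assign x (of P x)) = assign x (of P x) := by
  refine hom_ext fun y => ?_
  rw [map_apply_of hof ht]
  by_cases h : y = x
  · subst h; rw [assign_of_self, hof]
  · rw [assign_of_ne h, intertwiner_zero ht]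

/-- The coordinates of `t a` are determined separately by the coordinates of `a`. -/
theorem coord_intertwiner [Nonempty X] (hξ : ∀ ν, (ξ ν).IsLinear ↔ ν.IsLinear)
    (hof : ∀ x, t (of P x) = of P x) (ht : ∀ ν a, t (ν a) = ξ ν (t a))
    {a : FreeLieAlgebra P X} (ha : a ∈ freeLieLinear P X) (x : X) :
    coord x (t a) • of P x = t (coord x a • of P x) := by
  rw [← assign_apply_of_mem_linear x _ ha, ht, map_assign_self hof ht,
    assign_apply_of_mem_linear x _ ((intertwiner_mem_linear_iff hξ hof ht a).2 ha)]

/-- Comparing coordinates shows that `t` fixes `x + y`; substituting `a` and `b` for the two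
generators gives the general case. -/
theorem intertwiner_add [Finite X] [Nontrivial X] (hξ : ∀ ν, (ξ ν).IsLinear ↔ ν.IsLinear)
    (hof : ∀ x, t (of P x) = of P x) (ht : ∀ ν a, t (ν a) = ξ ν (t a))
    (a b : FreeLieAlgebra P X) : t (a + b) = t a + t b := by
  classical
  obtain ⟨x, y, hxy⟩ := exists_pair_ne X
  have hlin : of P x + of P y ∈ freeLieLinear P X := add_mem (of_mem_linear x) (of_mem_linear y)
  have hsum : t (of P x + of P y) = of P x + of P y := by
    refine eq_of_coord_eq ((intertwiner_mem_linear_iff hξ hof ht _).2 hlin) hlin fun z => ?_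
    have h := congrArg (coord z) (coord_intertwiner hξ hof ht hlin z)
    rw [map_smul, coord_of_self, smul_eq_mul, mul_one] at h
    rw [h, map_add]
    by_cases hx : x = z
    · subst hx
      rw [coord_of_self, coord_of_ne hxy.symm, add_zero, one_smul, hof, coord_of_self]
    · by_cases hy : y = z
      · subst hy
        rw [coord_of_self, coord_of_ne hxy, zero_add, one_smul, hof, coord_of_self]
      · rw [coord_of_ne hx, coord_of_ne hy, add_zero, zero_smul, intertwiner_zero ht, map_zero]
  have h := ht (lift P fun z => if z = x then a else b) (of P x + of P y)
  rw [hsum, map_add, map_add, map_apply_of hof ht, map_apply_of hof ht] at h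
  simpa [hxy.symm] using h

theorem exists_scalar [Finite X] [Nontrivial X] (hξ : ∀ ν, (ξ ν).IsLinear ↔ ν.IsLinear)
    (hof : ∀ x, t (of P x) = of P x) (ht : ∀ ν a, t (ν a) = ξ ν (t a)) :
    ∃ σ : P ≃+* P, ∀ (c : P) (a : FreeLieAlgebra P X), t (c • a) = σ c • t a := by
  obtain ⟨x, -⟩ := exists_pair_ne X
  let σ : P → P := fun c => coord x (t (c • of P x))
  have hx : ∀ c, t (c • of P x) = σ c • of P x := by
    intro c
    have := coord_intertwiner hξ hof ht (Submodule.smul_mem _ c (of_mem_linear x)) x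
    rw [map_smul, coord_of_self, smul_eq_mul, mul_one] at this
    exact this.symm
  have hsmul : ∀ (c : P) (a : FreeLieAlgebra P X), t (c • a) = σ c • t a := by
    intro c a
    have := ht (lift P fun _ : X => a) (c • of P x)
    rwa [hx, map_smul, map_smul, map_apply_of hof ht, lift_of_apply] at this
  let f : P →+* P :=
    { toFun := σ
      map_one' := by simp [σ, hof]
      map_mul' := fun c d => by
        simp only [σ]
        rw [mul_smul, hsmul, map_smul, smul_eq_mul]
      map_zero' := by simp [σ, intertwiner_zero ht]
      map_add' := fun c d => by
        simp only [σ]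
        rw [add_smul, intertwiner_add hξ hof ht, map_add] }
  have hf : Function.Bijective f := by
    refine ⟨f.injective, fun r => ?_⟩
    obtain ⟨a, ha⟩ := (intertwiner_bijective hof ht).2 (r • of P x)
    have hal : a ∈ freeLieLinear P X := by
      rw [← intertwiner_mem_linear_iff hξ hof ht, ha]
      exact Submodule.smul_mem _ _ (of_mem_linear x)
    -- `a` is linear because `t a = r • x` is, and its `x`-coordinate is the preimage of `r`.
    refine ⟨coord x a, ?_⟩
    have := coord_intertwiner hξ hof ht hal x
    rw [ha, hx] at this
    have := congrArg (coord x) this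
    change σ _ = r
    simpa using this.symm
  exact ⟨RingEquiv.ofBijective f hf, hsmul⟩

/-- `t ⁅x, y⁆` has weight two and is fixed by the retraction `d` onto the generators `x` and `y`. In
degree two the image of `d` is spanned by `⁅x, y⁆`, which yields `k`; substitution carries it to all
`a` and `b`. -/
theorem exists_lie_factor [Infinite P] [Nontrivial X] (hof : ∀ x, t (of P x) = of P x)
    (ht : ∀ ν a, t (ν a) = ξ ν (t a)) {σ : P ≃+* P}
    (hσ : ∀ (c : P) (a : FreeLieAlgebra P X), t (c • a) = σ c • t a) :
    ∃ k : P, ∀ a b : FreeLieAlgebra P X, t ⁅a, b⁆ = k • ⁅t a, t b⁆ := by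
  classical
  obtain ⟨x, y, hxy⟩ := exists_pair_ne X
  have hscale : ∀ c, ξ (scale X c) = scale X (σ c) := by
    intro c
    refine hom_ext fun z => ?_
    rw [map_apply_of hof ht, scale_of, scale_of, hσ, hof]
  have hmem : t ⁅of P x, of P y⁆ ∈ homogeneous P X 2 := by
    refine mem_homogeneous_of_scale fun c _ => ?_
    rw [← σ.apply_symm_apply c, ← hscale, ← ht, LieHom.map_lie, scale_of, scale_of, smul_lie,
      lie_smul, smul_smul, hσ, map_mul, pow_two]
  let d : FreeLieEnd P X := lift P fun z => if z = x ∨ z = y then of P z else 0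
  have hd : ∀ z, d (of P z) = if z = x ∨ z = y then of P z else 0 := fun z => lift_of_apply _ z
  have hξd : ξ d = d := by
    refine hom_ext fun z => ?_
    rw [map_apply_of hof ht, hd]
    split_ifs
    · exact hof z
    · exact intertwiner_zero ht
  have hfix : d (t ⁅of P x, of P y⁆) = t ⁅of P x, of P y⁆ := by
    conv_lhs => rw [← hξd]
    rw [← ht, LieHom.map_lie, hd, hd]
    simp
  have hspan : ∀ a ∈ homogeneous P X 2, d a ∈ Submodule.span P {⁅of P x, of P y⁆} := by
    intro a ha
    induction ha using Submodule.span_induction with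
    | mem a ha =>
      obtain ⟨u, v, rfl⟩ := IsBracketMonomial.eq_lie_of_eq_two ha rfl
      have h₁ : ⁅of P x, of P y⁆ ∈ Submodule.span P {⁅of P x, of P y⁆} :=
        Submodule.mem_span_singleton_self _
      have h₂ : ⁅of P y, of P x⁆ ∈ Submodule.span P {⁅of P x, of P y⁆} := by
        rw [← lie_skew (of P y) (of P x)]
        exact neg_mem h₁
      rw [LieHom.map_lie, hd, hd]
      split_ifs with hu hv hv
      · rcases hu with rfl | rfl <;> rcases hv with rfl | rfl <;> simp [h₁, h₂]
      all_goals simp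
    | zero => simp
    | add a b _ _ ha hb => rw [map_add]; exact add_mem ha hb
    | smul r a _ ha => rw [map_smul]; exact Submodule.smul_mem _ _ ha
  obtain ⟨k, hk⟩ := Submodule.mem_span_singleton.1 (hfix ▸ hspan _ hmem)
  refine ⟨k, fun a b => ?_⟩
  have h := ht (lift P fun z => if z = x then a else b) ⁅of P x, of P y⁆
  rw [← hk, map_smul, LieHom.map_lie, LieHom.map_lie, map_apply_of hof ht, map_apply_of hof ht] at h
  simpa [hxy.symm] using h

theorem isSemiInner_of_intertwiner [Infinite P] [Finite X] [Nontrivial X]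
    (hξ : ∀ ν, (ξ ν).IsLinear ↔ ν.IsLinear)
    (hof : ∀ x, t (of P x) = of P x) (ht : ∀ ν a, t (ν a) = ξ ν (t a)) : IsSemiInner ξ := by
  obtain ⟨σ, hσ⟩ := exists_scalar hξ hof ht
  have hbij := intertwiner_bijective hof ht
  obtain ⟨k, hk, hlie⟩ : ∃ k : P, k ≠ 0 ∧
      ∀ a b : FreeLieAlgebra P X, t ⁅a, b⁆ = k • ⁅t a, t b⁆ := by
    obtain ⟨k, hlie⟩ := exists_lie_factor hof ht hσ
    -- If `k = 0`, injectivity of `t` makes every bracket vanish and any nonzero constant serves.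
    -- This avoids proving the algebra nonabelian.
    by_cases hk : k = 0
    · have habel : ∀ a b : FreeLieAlgebra P X, ⁅a, b⁆ = 0 := fun a b => hbij.1 <| by
        rw [hlie, hk, zero_smul, intertwiner_zero ht]
      exact ⟨1, one_ne_zero, fun a b => by rw [habel, habel, smul_zero, intertwiner_zero ht]⟩
    · exact ⟨k, hk, hlie⟩
  let e : FreeLieAlgebra P X ≃+ FreeLieAlgebra P X :=
    (AddEquiv.ofBijective (AddMonoidHom.mk' t (intertwiner_add hξ hof ht)) hbij).trans
      (LinearEquiv.smulOfNeZero P (FreeLieAlgebra P X) k hk).toAddEquiv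
  have he : ∀ a, e a = k • t a := fun a => rfl
  refine ⟨⟨σ, e, fun a b => ?_, fun c a => ?_⟩, fun ν a => ?_⟩
  -- Both sides equal `k² ⁅t a, t b⁆`: this is why `t` is rescaled by `k`.
  · rw [he, he, he, hlie, smul_lie, lie_smul]
  · rw [he, he, hσ, smul_comm]
  · change ξ ν a = e (ν (e.symm a))
    conv_lhs => rw [← e.apply_symm_apply a]
    -- Since `ξ ν` is linear over `P`, the rescaling does not disturb the intertwining.
    rw [he, he, map_smul, ht]

end Intertwiner

theorem isSemiInner_of_isLinear_map_iff [Infinite P] [Finite X] [Nontrivial X]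
    {ξ : FreeLieEnd P X ≃* FreeLieEnd P X} (hξ : ∀ ν, (ξ ν).IsLinear ↔ ν.IsLinear) :
    IsSemiInner ξ := by
  obtain ⟨g, hg, t, hof, ht⟩ := exists_conj_and_intertwiner ξ hξ
  refine IsSemiInner.of_trans_conj (g := g) (isSemiInner_of_intertwiner (fun ν => ?_) hof ht)
  rw [← hξ ν, MulEquiv.trans_apply, conj_apply]
  have hmul : ∀ {f f' : FreeLieEnd P X}, f.IsLinear → f'.IsLinear → (f * f').IsLinear :=
    fun hf hf' x => hf.apply_mem (hf' x)
  have hg' : ((g⁻¹ : FreeLieAut P X) : FreeLieEnd P X).IsLinear := FreeLieAut.isLinear_inv hg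
  refine ⟨fun h => ?_, fun h => hmul (hmul hg h) hg'⟩
  have : ξ ν = (g⁻¹ : FreeLieAut P X) * (g * ξ ν * (g⁻¹ : FreeLieAut P X)) * g := by
    simp [mul_assoc]
  rw [this]
  exact hmul (hmul hg' h) hg

theorem isSemiInner_of_map_linearAut [Infinite P] [Finite X] [Nontrivial X]
    {ξ : FreeLieEnd P X ≃* FreeLieEnd P X} {g : FreeLieAut P X}
    (h : (freeLieLinearAut P X).map (Units.mapEquiv ξ).toMonoidHom =
      (freeLieLinearAut P X).map (MulAut.conj g).toMonoidHom) : IsSemiInner ξ := by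
  refine IsSemiInner.of_trans_conj (g := g⁻¹)
    (isSemiInner_of_isLinear_map_iff (isLinear_map_iff fun u => ?_))
  have hu : Units.mapEquiv (ξ.trans (conj g⁻¹)) u = g⁻¹ * Units.mapEquiv ξ u * g :=
    Units.ext (by simp [conj_apply])
  have h₁ : Units.mapEquiv ξ u ∈ (freeLieLinearAut P X).map (Units.mapEquiv ξ).toMonoidHom ↔
      u ∈ freeLieLinearAut P X :=
    Subgroup.mem_map_iff_mem (f := (Units.mapEquiv ξ).toMonoidHom) (Units.mapEquiv ξ).injective
  rw [hu, ← h₁, h]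
  constructor
  · intro hm
    exact ⟨_, hm, by simp [mul_assoc]⟩
  · rintro ⟨w, hw, hw'⟩
    have : g⁻¹ * Units.mapEquiv ξ u * g = w := by
      rw [← hw']
      simp [mul_assoc]
    rwa [this]

end FreeLieEnd

/-! ### The equivalence. -/

theorem mainTheorem9 (P : Type*) [Field P] [Infinite P] (X : Type*) [Finite X]
    (hX : Nat.card X ≠ 1) :
    (∀ ξ : FreeLieEnd P X ≃* FreeLieEnd P X, FreeLieEnd.IsSemiInner ξ) ↔
      (∀ ξ : FreeLieEnd P X ≃* FreeLieEnd P X, ∃ g : FreeLieAut P X,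
        (freeLieLinearAut P X).map (Units.mapEquiv ξ).toMonoidHom =
          (freeLieLinearAut P X).map (MulAut.conj g).toMonoidHom) := by
  refine ⟨fun h ξ => (h ξ).map_linearAut, fun h ξ => ?_⟩
  rcases isEmpty_or_nonempty X with hE | hN
  -- Without generators there is only one endomorphism, so the identity pair works.
  · refine ⟨⟨RingEquiv.refl P, AddEquiv.refl _, fun _ _ => rfl, fun _ _ => rfl⟩, fun ν a => ?_⟩
    have : ξ ν = ν := FreeLieAlgebra.hom_ext fun x => hE.elim x
    rw [this]
    rfl
  · have : Nontrivial X := by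
      rw [← Finite.one_lt_card_iff_nontrivial]
      have := Nat.card_pos (α := X)
      omega
    obtain ⟨g, hg⟩ := h ξ
    exact FreeLieEnd.isSemiInner_of_map_linearAut hg
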